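/- Let $H=(V,E)$ be a finite hypergraph, that is, $V$ is a finite set and $E$ is a collection of subsets of $V$; its dimension $\dim H$ is the maximum edge size. For $\emptyset\ne X\subseteq V$ and $j\ge 1$ put $N_j(X,H)=\{Y\subseteq V: X\cup Y\in E,\ X\cap Y=\emptyset,\ |Y|=j\}$ and $d_j(X,H)=|N_j(X,H)|^{1/j}$; put $\Delta_i(H)=\max\{d_{i-|X|}(X,H): X\subseteq V,\ 0<|X|<i\}$ and $\Delta(H)=\max\{\Delta_i(H): 2\le i\le \dim H\}$ (a maximum over an empty set is $0$). One stage of the Beame–Luby algorithm BL on $H$ with marking probability $p$ is the following. Mark every vertex independently with probability $p$; unmark all vertices of each edge that is fully marked; let $I'$ be the set of vertices that are still marked. Remove $I'$ from $V$ and replace each edge $e$ by $e\setminus I'$; discard every edge that properly contains another edge; finally remove every singleton edge $\{v\}$ together with its vertex $v$. Let $H^{+}$ be the resulting hypergraph. Then there are absolute constants $c>0$ and $n_0$ such that the following holds for all $n\ge n_0$ and all integers $d\ge 0$ with $d\le \frac{\log\log n}{4\log\log\log n}$. Let $H=(V,E)$ be any hypergraph with at most $n$ vertices and dimension at most $d$,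 and let $p=1/(a\,\Delta(H))$, where $a=2^{d+1}$ or $a=5d$ (with $p=0$ if $a\,\Delta(H)=0$). With probability at least $1-n^{-c\log n}$, simultaneously for all $2\le j\le d$ and all nonempty $X\subseteq V$ with $|X|<j$, one stage of BL on $H$ increases $d_{j-|X|}(X,H)$ by less than $\sum_{k=j+1}^{d}(\log n)^{2(k-j)}\Delta_k(H)$, that is, $$d_{j-|X|}(X,H^{+})-d_{j-|X|}(X,H)<\sum_{k=j+1}^{d}(\log n)^{2(k-j)}\,\Delta_k(H),$$ where $<$ is replaced by $\le$ if the right-hand side is $0$ (that is, if $H$ has no edge of size larger than $j$). Here $\log$ is the natural logarithm. -/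

import Mathlib

open scoped NNReal

/-- A finite hypergraph: a finite vertex set and a finite collection of subsets of it. -/
structure FinHypergraph (α : Type*) where
  verts : Finset α
  edges : Finset (Finset α)
  edge_subset : ∀ e ∈ edges, e ⊆ verts

namespace FinHypergraph

variable {α : Type*} [DecidableEq α]

/-- The dimension: the maximum edge size. -/
def dim (H : FinHypergraph α) : ℕ := H.edges.sup Finset.card

/-- `N_j(x, H)`: the sets `y ⊆ V` of size `j`, disjoint from `x`, with `x ∪ y` an edge. -/
def nbr (H : FinHypergraph α) (j : ℕ) (x : Finset α) : Finset (Finset α) :=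
  H.verts.powerset.filter fun y => x ∪ y ∈ H.edges ∧ Disjoint x y ∧ y.card = j

/-- The normalized degree `d_j(x, H) = |N_j(x, H)| ^ (1 / j)`, used for `j ≥ 1` only. -/
noncomputable def normDeg (H : FinHypergraph α) (j : ℕ) (x : Finset α) : ℝ≥0 :=
  ((H.nbr j x).card : ℝ≥0) ^ (1 / (j : ℝ))

/-- `Δ_i(H)`: the maximum of `d_{i - |x|}(x, H)` over `x ⊆ V` with `0 < |x| < i`. -/
noncomputable def maxDeg (H : FinHypergraph α) (i : ℕ) : ℝ≥0 :=
  (H.verts.powerset.filter fun x => 0 < x.card ∧ x.card < i).sup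
    fun x => H.normDeg (i - x.card) x

/-- `Δ(H)`: the maximum of `Δ_i(H)` over `2 ≤ i ≤ dim H`. -/
noncomputable def totalMaxDeg (H : FinHypergraph α) : ℝ≥0 :=
  (Finset.Icc 2 H.dim).sup H.maxDeg

/-- The set `I'` that a stage adds to the independent set when `S` is the set of marked vertices:
every vertex of a fully marked edge is unmarked. -/
def added (H : FinHypergraph α) (S : Finset α) : Finset α :=
  S.filter fun v => ∀ e ∈ H.edges, e ⊆ S → v ∉ e

/-- The edges after the vertices in `I'` have been deleted from each of them. -/
def trimmed (H : FinHypergraph α) (S : Finset α) : Finset (Finset α) :=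
  H.edges.image fun e => e \ H.added S

/-- The trimmed edges that contain no smaller trimmed edge. -/
def minimalTrimmed (H : FinHypergraph α) (S : Finset α) : Finset (Finset α) :=
  (H.trimmed S).filter fun e => ∀ f ∈ H.trimmed S, f ⊆ e → f = e

/-- The hypergraph after one stage of the Beame–Luby algorithm in which exactly the vertices in
`S` were marked: the vertices of `I'` are removed and the edges trimmed, edges that contain a
smaller edge are discarded, and then every singleton edge is removed together with its vertex. -/
def stage (H : FinHypergraph α) (S : Finset α) : FinHypergraph α where
  verts := (H.verts \ H.added S).filter fun v => {v} ∉ H.minimalTrimmed S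
  edges := (H.minimalTrimmed S).filter fun e => e.card ≠ 1
  edge_subset := by
    intro e he v hv
    simp only [minimalTrimmed, Finset.mem_filter] at he ⊢
    obtain ⟨⟨heT, hmin⟩, hcard⟩ := he
    refine ⟨?_, ?_⟩
    · obtain ⟨f, hf, rfl⟩ := Finset.mem_image.1 heT
      exact Finset.sdiff_subset_sdiff (H.edge_subset f hf) subset_rfl hv
    · rintro ⟨hvT, -⟩
      have h := hmin {v} hvT (Finset.singleton_subset_iff.2 hv)
      exact hcard (h ▸ Finset.card_singleton v)

open Classical in
/-- The probability of the event `P` for the random set of marked vertices, where each vertex of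
`H` is marked independently with probability `p`. -/
noncomputable def markProb (H : FinHypergraph α) (p : ℝ) (P : Finset α → Prop) : ℝ :=
  ∑ S ∈ H.verts.powerset.filter P, p ^ S.card * (1 - p) ^ (H.verts \ S).card

/-- The change of `d_{j - |X|}(X, H)` in the stage in which the vertices in `S` were marked. -/
noncomputable def increase (H : FinHypergraph α) (S : Finset α) (j : ℕ) (X : Finset α) : ℝ :=
  ((H.stage S).normDeg (j - X.card) X : ℝ) - (H.normDeg (j - X.card) X : ℝ)

/-- `∑_{k > j} (log n) ^ (2 (k - j)) * Δ_k(H)`, where `k` runs up to `d`. -/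
noncomputable def migrationBound (H : FinHypergraph α) (n d j : ℕ) : ℝ :=
  ∑ k ∈ Finset.Ioc j d, Real.log n ^ (2 * (k - j)) * (H.maxDeg k : ℝ)

end FinHypergraph

/-! An edge of size `j` containing `X` after the stage either was already an edge or arose from an
edge of size `k > j` by deleting `k - j` marked vertices. Since `x ↦ x ^ (1 / (j - |X|))` is
subadditive, the increase is at most the sum over `k` of the roots of the numbers of such migrants
(`increase_le_sum`).

Counted with their deleted parts, the migrants form a homogeneous polynomial of degree `k - j` in
the marking indicators. Conditioning on a marked set `T` leaves an expectation of at most `Δ_k ^ (j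
- |X|)`: each vertex still to be marked costs `p = 1 / (a Δ)`, where `Δ` pays for a degree factor
and `a` for the binomial coefficient (`migrants_partial_expectation_le`). A moment computation and
Markov's inequality (`moment_le`, `tail_le`) then show that exceeding this by a factor `R ^ (k - j)`
has probability at most `exp (d - R / e)`. With `R = (log n) ^ 2` this beats a union bound over the
triples `(j, k, X)`, of which there are at most `(d + 1) ^ 2 (n + 1) ^ d`. -/

namespace FinHypergraph

variable {α : Type*} [DecidableEq α]

/-! ### Independent marking and counting of small sets -/

/-- The weight of the outcome `S` when each element of `V` is chosen with probability `p`. -/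
noncomputable def weight (V : Finset α) (p : ℝ) (S : Finset α) : ℝ :=
  p ^ S.card * (1 - p) ^ (V \ S).card

lemma weight_nonneg (V : Finset α) {p : ℝ} (hp0 : 0 ≤ p) (hp1 : p ≤ 1) (S : Finset α) :
    0 ≤ weight V p S :=
  mul_nonneg (pow_nonneg hp0 _) (pow_nonneg (sub_nonneg.2 hp1) _)

lemma sum_weight_superset (V : Finset α) (p : ℝ) {U : Finset α} (hU : U ⊆ V) :
    ∑ S ∈ V.powerset, weight V p S * (if U ⊆ S then 1 else 0) = p ^ U.card := by
  -- Expanding the product over `S` kills exactly the terms with `U ⊄ S`, because the second summand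
  -- vanishes on `U`.
  have h := Finset.prod_add (fun _ : α => p) (fun v => if v ∈ U then 0 else 1 - p) V
  have hl : ∏ v ∈ V, (p + if v ∈ U then 0 else 1 - p) = p ^ U.card := by
    have : ∀ v ∈ V, (p + if v ∈ U then 0 else 1 - p) = if v ∈ U then p else 1 := by
      intro v _
      split_ifs <;> ring
    rw [Finset.prod_congr rfl this, Finset.prod_ite_mem, Finset.inter_eq_right.2 hU,
      Finset.prod_const]
  rw [← hl, h]
  refine Finset.sum_congr rfl fun S _ => ?_
  rw [Finset.prod_const, weight, mul_assoc]
  congr 1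
  split_ifs with hUS
  · rw [mul_one, ← Finset.prod_const]
    refine Finset.prod_congr rfl fun v hv => ?_
    rw [if_neg fun hvU => (Finset.mem_sdiff.1 hv).2 (hUS hvU)]
  · obtain ⟨v, hvU, hvS⟩ := Finset.not_subset.1 hUS
    rw [mul_zero]
    symm
    exact Finset.prod_eq_zero (i := v) (Finset.mem_sdiff.2 ⟨hU hvU, hvS⟩) (by simp [hvU])

lemma sum_weight (V : Finset α) (p : ℝ) : ∑ S ∈ V.powerset, weight V p S = 1 := by
  simpa using sum_weight_superset V p (Finset.empty_subset V)

/-- A set has at most `(|U| + 1) ^ q` subsets of size at most `q`. -/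
lemma card_subsets_card_le (U : Finset α) (q : ℕ) :
    (U.powerset.filter fun T => T.card ≤ q).card ≤ (U.card + 1) ^ q := by
  have h : (U.powerset.filter fun T => T.card ≤ q) ⊆
      (Finset.range (q + 1)).biUnion fun t => U.powersetCard t := by
    intro T hT
    simp only [Finset.mem_filter, Finset.mem_powerset] at hT
    simp only [Finset.mem_biUnion, Finset.mem_range, Finset.mem_powersetCard]
    exact ⟨T.card, by omega, hT.1, rfl⟩
  refine (Finset.card_le_card h).trans (Finset.card_biUnion_le.trans ?_)
  rw [add_pow]
  refine Finset.sum_le_sum fun t ht => ?_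
  rw [Finset.card_powersetCard, one_pow, mul_one]
  exact (Nat.choose_le_pow _ _).trans
    (Nat.le_mul_of_pos_right _ (Nat.choose_pos (Nat.lt_succ_iff.1 (Finset.mem_range.1 ht))))

/-! ### Moments and tails of homogeneous random polynomials -/

section Moments

variable {ι : Type*}

/-- If every partial expectation of a random polynomial is at most `M`, then so is the sum of the
conditional probabilities given a marked set `U`, up to the number of small subsets of `U`. -/
lemma sum_pow_card_sdiff_le (V : Finset α) {p M : ℝ} (hp0 : 0 ≤ p) (q : ℕ)
    (I : Finset ι) (z : ι → Finset α) (hzV : ∀ i ∈ I, z i ⊆ V) (hzq : ∀ i ∈ I, (z i).card = q)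
    (hM : ∀ T ⊆ V, T.card ≤ q →
      ((I.filter fun i => T ⊆ z i).card : ℝ) * p ^ (q - T.card) ≤ M)
    (hM0 : 0 ≤ M) (U : Finset α) :
    ∑ i ∈ I, p ^ (z i \ U).card ≤ ((U.card : ℝ) + 1) ^ q * M := by
  -- Group the terms by their trace `T = z i ∩ U`: each class is controlled by the partial
  -- expectation at `T`, and the possible traces are few.
  have hmaps : ∀ i ∈ I, z i ∩ U ∈
      (U.powerset.filter fun T => T.card ≤ q).filter fun T => T ⊆ V := by
    intro i hi
    simp only [Finset.mem_filter, Finset.mem_powerset]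
    exact ⟨⟨Finset.inter_subset_right,
      (Finset.card_le_card Finset.inter_subset_left).trans (hzq i hi).le⟩,
      Finset.inter_subset_left.trans (hzV i hi)⟩
  rw [← Finset.sum_fiberwise_of_maps_to hmaps]
  have hfib : ∀ T ∈ (U.powerset.filter fun T => T.card ≤ q).filter fun T => T ⊆ V,
      ∑ i ∈ I.filter (fun i => z i ∩ U = T), p ^ (z i \ U).card ≤ M := by
    intro T hT
    simp only [Finset.mem_filter, Finset.mem_powerset] at hT
    refine le_trans ?_ (hM T hT.2 hT.1.2)
    have : ∀ i ∈ I.filter (fun i => z i ∩ U = T), p ^ (z i \ U).card = p ^ (q - T.card) := by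
      intro i hi
      obtain ⟨hiI, rfl⟩ := Finset.mem_filter.1 hi
      rw [Finset.card_sdiff, Finset.inter_comm, hzq i hiI]
    rw [Finset.sum_congr rfl this, Finset.sum_const, nsmul_eq_mul]
    refine mul_le_mul_of_nonneg_right ?_ (pow_nonneg hp0 _)
    refine Nat.cast_le.2 (Finset.card_le_card fun i hi => ?_)
    obtain ⟨hiI, rfl⟩ := Finset.mem_filter.1 hi
    exact Finset.mem_filter.2 ⟨hiI, Finset.inter_subset_left⟩
  refine (Finset.sum_le_card_nsmul _ _ _ hfib).trans ?_
  rw [nsmul_eq_mul]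
  refine mul_le_mul_of_nonneg_right ?_ hM0
  exact_mod_cast (Finset.card_filter_le _ _).trans (card_subsets_card_le U q)

/-- Peeling one factor off the power replaces `U` by `U ∪ z i`, which adds at most `q` vertices.
Thus `K` bounds the marked set throughout the induction, and each peeling costs a factor of at most
`M * K ^ q`. -/
lemma moment_le (V : Finset α) {p M K : ℝ} (hp0 : 0 ≤ p) {q : ℕ} (hq : 1 ≤ q)
    (I : Finset ι) (z : ι → Finset α) (hzV : ∀ i ∈ I, z i ⊆ V) (hzq : ∀ i ∈ I, (z i).card = q)
    (hM : ∀ T ⊆ V, T.card ≤ q →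
      ((I.filter fun i => T ⊆ z i).card : ℝ) * p ^ (q - T.card) ≤ M)
    (hM0 : 0 ≤ M) (m : ℕ) :
    ∀ U ⊆ V, (U.card : ℝ) + q * m ≤ K →
      ∑ S ∈ V.powerset, weight V p S * (if U ⊆ S then 1 else 0) *
        ((I.filter fun i => z i ⊆ S).card : ℝ) ^ m ≤ p ^ U.card * (M * K ^ q) ^ m := by
  induction m with
  | zero =>
    intro U hU _
    simpa using (sum_weight_superset V p hU).le
  | succ m ih =>
    intro U hU hK
    have hq' : (1 : ℝ) ≤ q := by exact_mod_cast hq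
    have hqm : (0 : ℝ) ≤ q * m := by positivity
    push_cast at hK
    have hK0 : 0 ≤ K := by
      have : (0 : ℝ) ≤ U.card := Nat.cast_nonneg _
      nlinarith
    have hstep : ∀ S, weight V p S * (if U ⊆ S then 1 else 0) *
        ((I.filter fun i => z i ⊆ S).card : ℝ) ^ (m + 1) =
        ∑ i ∈ I, weight V p S * (if U ∪ z i ⊆ S then 1 else 0) *
          ((I.filter fun i => z i ⊆ S).card : ℝ) ^ m := by
      intro S
      rw [← Finset.sum_mul, ← Finset.mul_sum, pow_succ', ← mul_assoc, mul_assoc (weight V p S)]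
      congr 2
      rw [Finset.card_filter]
      push_cast
      rw [Finset.mul_sum]
      refine Finset.sum_congr rfl fun i _ => ?_
      by_cases h1 : U ⊆ S <;> by_cases h2 : z i ⊆ S <;> simp [Finset.union_subset_iff, h1, h2]
    rw [Finset.sum_congr rfl fun S _ => hstep S, Finset.sum_comm]
    have hi : ∀ i ∈ I, ∑ S ∈ V.powerset, weight V p S * (if U ∪ z i ⊆ S then 1 else 0) *
        ((I.filter fun i => z i ⊆ S).card : ℝ) ^ m ≤
          p ^ (z i \ U).card * (p ^ U.card * (M * K ^ q) ^ m) := by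
      intro i hi
      have hcard : (U ∪ z i).card = (z i \ U).card + U.card := by
        rw [Finset.card_sdiff_add_card, Finset.union_comm]
      have hle : ((U ∪ z i).card : ℝ) ≤ U.card + q := by
        exact_mod_cast (Finset.card_union_le _ _).trans (by rw [hzq i hi])
      refine (ih (U ∪ z i) (Finset.union_subset hU (hzV i hi)) (by linarith)).trans_eq ?_
      rw [hcard, pow_add, mul_assoc]
    refine (Finset.sum_le_sum hi).trans ?_
    rw [← Finset.sum_mul, pow_succ', mul_left_comm]
    have hUK : ((U.card : ℝ) + 1) ^ q ≤ K ^ q :=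
      pow_le_pow_left₀ (by positivity) (by linarith) _
    have h1 : ∑ i ∈ I, p ^ (z i \ U).card ≤ M * K ^ q :=
      (sum_pow_card_sdiff_le V hp0 q I z hzV hzq hM hM0 U).trans
        ((mul_le_mul_of_nonneg_right hUK hM0).trans_eq (mul_comm _ _))
    exact mul_le_mul_of_nonneg_left (mul_le_mul_of_nonneg_right h1 (by positivity))
      (pow_nonneg hp0 _)

/-- Tail bound for a homogeneous random polynomial of degree `q` whose partial expectations are all
at most `M`. -/
lemma tail_le (V : Finset α) {p M : ℝ} (hp0 : 0 ≤ p) (hp1 : p ≤ 1) {q : ℕ} (hq : 1 ≤ q)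
    (I : Finset ι) (z : ι → Finset α) (hzV : ∀ i ∈ I, z i ⊆ V) (hzq : ∀ i ∈ I, (z i).card = q)
    (hM : ∀ T ⊆ V, T.card ≤ q →
      ((I.filter fun i => T ⊆ z i).card : ℝ) * p ^ (q - T.card) ≤ M)
    (hM0 : 0 < M) {R : ℝ} (hR : 0 < R) :
    ∑ S ∈ V.powerset.filter (fun S => M * R ^ q ≤ ((I.filter fun i => z i ⊆ S).card : ℝ)),
      weight V p S ≤ Real.exp (q - R / Real.exp 1) := by
  set K : ℝ := R / Real.exp 1 with hKdef
  have hq' : (0 : ℝ) < q := by exact_mod_cast hq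
  have hK0 : 0 < K := by positivity
  -- The largest moment allowed by `q * m ≤ K`. As `R = e * K`, Markov gains `exp (-(q * m))`;
  -- rounding down loses at most `exp q`.
  set m : ℕ := ⌊K / q⌋₊ with hm
  have hmK : (q : ℝ) * m ≤ K := by
    have := Nat.floor_le (div_nonneg hK0.le hq'.le)
    rw [← hm, le_div_iff₀ hq'] at this
    linarith
  have hmK' : K < q * m + q := by
    have := Nat.lt_floor_add_one (K / q)
    rw [← hm, div_lt_iff₀ hq'] at this
    linarith
  have hmom := moment_le V hp0 hq I z hzV hzq hM hM0.le m (K := K) ∅ (Finset.empty_subset _)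
    (by simpa using hmK)
  simp only [Finset.empty_subset, if_true, mul_one, Finset.card_empty, pow_zero, one_mul] at hmom
  have hpos : 0 < (M * R ^ q) ^ m := by positivity
  have hmarkov : (∑ S ∈ V.powerset.filter
      (fun S => M * R ^ q ≤ ((I.filter fun i => z i ⊆ S).card : ℝ)), weight V p S) *
        (M * R ^ q) ^ m ≤ (M * K ^ q) ^ m := by
    refine le_trans ?_ hmom
    rw [Finset.sum_mul]
    refine (Finset.sum_le_sum fun S hS => ?_).trans
      (Finset.sum_le_sum_of_subset_of_nonneg (Finset.filter_subset _ _) fun S _ _ =>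
        mul_nonneg (weight_nonneg V hp0 hp1 S) (by positivity))
    exact mul_le_mul_of_nonneg_left
      (pow_le_pow_left₀ (by positivity) (Finset.mem_filter.1 hS).2 _) (weight_nonneg V hp0 hp1 S)
  have hRK : R = Real.exp 1 * K := by rw [hKdef]; field_simp
  have hsplit : (M * R ^ q) ^ m = (M * K ^ q) ^ m * Real.exp (q * m) := by
    rw [hRK, mul_pow (Real.exp 1), ← Real.exp_nat_mul, mul_one, mul_left_comm, mul_pow,
      ← Real.exp_nat_mul, mul_comm, mul_comm (m : ℝ)]
  have hle : (∑ S ∈ V.powerset.filter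
      (fun S => M * R ^ q ≤ ((I.filter fun i => z i ⊆ S).card : ℝ)), weight V p S) *
        Real.exp (q * m) ≤ 1 := by
    have hc : 0 < (M * K ^ q) ^ m := by positivity
    rw [hsplit] at hmarkov
    nlinarith
  calc _ ≤ 1 / Real.exp (q * m) := (le_div_iff₀ (Real.exp_pos _)).2 hle
    _ = Real.exp (-(q * m)) := by rw [Real.exp_neg, one_div]
    _ ≤ Real.exp (q - K) := Real.exp_le_exp.2 (by linarith)

end Moments

/-! ### Normalized degrees -/

lemma mem_nbr {H : FinHypergraph α} {j : ℕ} {x y : Finset α} :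
    y ∈ H.nbr j x ↔ y ⊆ H.verts ∧ x ∪ y ∈ H.edges ∧ Disjoint x y ∧ y.card = j := by
  simp [nbr]

lemma normDeg_le_maxDeg (H : FinHypergraph α) {k : ℕ} {X : Finset α} (hX : X ⊆ H.verts)
    (h0 : 0 < X.card) (hk : X.card < k) : H.normDeg (k - X.card) X ≤ H.maxDeg k := by
  have hmem : X ∈ H.verts.powerset.filter fun x => 0 < x.card ∧ x.card < k :=
    Finset.mem_filter.2 ⟨Finset.mem_powerset.2 hX, h0, hk⟩
  unfold maxDeg
  generalize H.normDeg = f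
  exact Finset.le_sup (f := fun x => f (k - x.card) x) hmem

lemma card_nbr_le (H : FinHypergraph α) {k : ℕ} {X : Finset α} (hX : X ⊆ H.verts)
    (h0 : 0 < X.card) (hk : X.card < k) :
    ((H.nbr (k - X.card) X).card : ℝ) ≤ (H.maxDeg k : ℝ) ^ (k - X.card) := by
  have h := pow_le_pow_left₀ zero_le (H.normDeg_le_maxDeg hX h0 hk) (k - X.card)
  rw [normDeg, one_div, NNReal.rpow_inv_natCast_pow _ (by omega)] at h
  exact_mod_cast h

lemma maxDeg_le_totalMaxDeg (H : FinHypergraph α) {k : ℕ} (hk : 2 ≤ k) :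
    H.maxDeg k ≤ H.totalMaxDeg := by
  by_cases hd : k ≤ H.dim
  · exact Finset.le_sup (f := H.maxDeg) (Finset.mem_Icc.2 ⟨hk, hd⟩)
  · refine (Finset.sup_le fun X hX => ?_).trans zero_le
    obtain ⟨-, h0, hXk⟩ := Finset.mem_filter.1 hX
    have : H.nbr (k - X.card) X = ∅ := by
      refine Finset.eq_empty_of_forall_notMem fun Y hY => hd ?_
      obtain ⟨-, he, hdisj, hc⟩ := mem_nbr.1 hY
      have h1 : (X ∪ Y).card ≤ H.dim := Finset.le_sup (f := Finset.card) he
      rw [Finset.card_union_of_disjoint hdisj] at h1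
      omega
    -- A zero exponent would give `0 ^ 0 = 1`.
    have hne : (1 / ((k - X.card : ℕ) : ℝ)) ≠ 0 := by
      have : ((k - X.card : ℕ) : ℝ) ≠ 0 := by
        exact_mod_cast (by omega : k - X.card ≠ 0)
      positivity
    rw [normDeg, this, Finset.card_empty, Nat.cast_zero, NNReal.zero_rpow hne]

/-- A positive degree is a root of a positive integer. This keeps the marking probability at most
`1`. -/
lemma one_le_totalMaxDeg (H : FinHypergraph α) (h : 0 < H.totalMaxDeg) :
    1 ≤ H.totalMaxDeg := by
  rw [totalMaxDeg, Finset.lt_sup_iff] at h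
  obtain ⟨k, hk, hpos⟩ := h
  rw [maxDeg, Finset.lt_sup_iff] at hpos
  obtain ⟨X, hX, hXpos⟩ := hpos
  obtain ⟨hXV, hX0, hXk⟩ := Finset.mem_filter.1 hX
  refine le_trans ?_ ((H.normDeg_le_maxDeg (Finset.mem_powerset.1 hXV) hX0 hXk).trans
    (H.maxDeg_le_totalMaxDeg (Finset.mem_Icc.1 hk).1))
  have hne : (H.nbr (k - X.card) X).card ≠ 0 := by
    intro h0
    have hne : (1 / ((k - X.card : ℕ) : ℝ)) ≠ 0 := by
      have : ((k - X.card : ℕ) : ℝ) ≠ 0 := by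
        exact_mod_cast (by omega : k - X.card ≠ 0)
      positivity
    rw [normDeg, h0, Nat.cast_zero, NNReal.zero_rpow hne] at hXpos
    exact lt_irrefl _ hXpos
  refine NNReal.one_le_rpow ?_ (by positivity)
  exact_mod_cast Nat.one_le_iff_ne_zero.2 hne

/-! ### Migrating edges and their partial expectations -/

/-- The pairs `(W, Z)` such that `X ∪ W` is an edge of size `k` which turns into the edge
`X ∪ (W \ Z)` of size `j` when `Z` is removed. -/
def migrants (H : FinHypergraph α) (k j : ℕ) (X : Finset α) : Finset (Finset α × Finset α) :=
  (H.nbr (k - X.card) X ×ˢ H.verts.powerset).filter fun w => w.2 ⊆ w.1 ∧ w.2.card = k - j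

lemma mem_migrants {H : FinHypergraph α} {k j : ℕ} {X : Finset α} {w : Finset α × Finset α} :
    w ∈ H.migrants k j X ↔ (w.1 ∈ H.nbr (k - X.card) X ∧ w.2 ⊆ H.verts) ∧
      w.2 ⊆ w.1 ∧ w.2.card = k - j := by
  simp [migrants]

/-- Removing `T` from both components is injective, since `T ⊆ Z ⊆ W`, and turns `W` into a
neighbour of `X ∪ T`. -/
lemma card_migrants_superset_le (H : FinHypergraph α) {k j : ℕ} {X T : Finset α}
    (hXT : Disjoint X T) :
    ((H.migrants k j X).filter fun w => T ⊆ w.2).card ≤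
      (H.nbr (k - (X ∪ T).card) (X ∪ T)).card *
        (k - (X ∪ T).card).choose (k - j - T.card) := by
  have hcard : ((H.nbr (k - (X ∪ T).card) (X ∪ T)).sigma fun W =>
      W.powersetCard (k - j - T.card)).card = (H.nbr (k - (X ∪ T).card) (X ∪ T)).card *
        (k - (X ∪ T).card).choose (k - j - T.card) := by
    rw [Finset.card_sigma, Finset.sum_const_nat]
    intro W hW
    rw [Finset.card_powersetCard, (mem_nbr.1 hW).2.2.2]
  rw [← hcard]
  refine Finset.card_le_card_of_injOn (fun w => ⟨w.1 \ T, w.2 \ T⟩) ?_ ?_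
  · intro w hw
    obtain ⟨hw, hT⟩ := Finset.mem_filter.1 (Finset.mem_coe.1 hw)
    obtain ⟨⟨hW, hZV⟩, hZW, hZc⟩ := mem_migrants.1 hw
    obtain ⟨hWV, hWe, hWd, hWc⟩ := mem_nbr.1 hW
    have hTW := hT.trans hZW
    refine Finset.mem_coe.2 (Finset.mem_sigma.2 ⟨mem_nbr.2 ⟨?_, ?_, ?_, ?_⟩,
      Finset.mem_powersetCard.2 ⟨?_, ?_⟩⟩)
    · exact Finset.sdiff_subset.trans hWV
    · rwa [Finset.union_assoc, Finset.union_sdiff_of_subset hTW]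
    · exact Finset.disjoint_union_left.2 ⟨hWd.mono_right Finset.sdiff_subset,
        Finset.disjoint_sdiff⟩
    · simp only
      rw [Finset.card_sdiff_of_subset hTW, hWc, Finset.card_union_of_disjoint hXT, Nat.sub_sub]
    · exact Finset.sdiff_subset_sdiff hZW subset_rfl
    · simp only
      rw [Finset.card_sdiff_of_subset hT, hZc]
  · intro w hw w' hw' h
    obtain ⟨hw, hT⟩ := Finset.mem_filter.1 (Finset.mem_coe.1 hw)
    obtain ⟨hw', hT'⟩ := Finset.mem_filter.1 (Finset.mem_coe.1 hw')
    have hZW := (mem_migrants.1 hw).2.1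
    have hZW' := (mem_migrants.1 hw').2.1
    simp only [Sigma.mk.injEq, heq_eq_eq] at h
    refine Prod.ext ?_ ?_
    · rw [← Finset.union_sdiff_of_subset (hT.trans hZW), h.1,
        Finset.union_sdiff_of_subset (hT'.trans hZW')]
    · rw [← Finset.union_sdiff_of_subset hT, h.2, Finset.union_sdiff_of_subset hT']

lemma choose_le_pow_of_marking_constant {d r s : ℕ} {a : ℝ}
    (ha : a = 2 ^ (d + 1) ∨ a = 5 * d) (hr : r ≤ d) : (r.choose s : ℝ) ≤ a ^ s := by
  rcases ha with rfl | rfl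
  · rcases Nat.eq_zero_or_pos s with rfl | hs
    · simp
    · have h1 : (r.choose s : ℝ) ≤ 2 ^ (d + 1) := by
        exact_mod_cast (Nat.choose_le_two_pow r s).trans
          (Nat.pow_le_pow_right (by norm_num) (by omega))
      exact h1.trans (le_self_pow₀ (one_le_pow₀ (by norm_num)) hs.ne')
  · have h1 : (r.choose s : ℝ) ≤ (r : ℝ) ^ s := by exact_mod_cast Nat.choose_le_pow r s
    refine h1.trans (pow_le_pow_left₀ (by positivity) ?_ _)
    have : (r : ℝ) ≤ d := by exact_mod_cast hr
    have h0 : (0 : ℝ) ≤ d := by positivity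
    linarith

/-- All partial expectations of the number of migrants are at most `Δ_k ^ (j - |X|)`. -/
lemma migrants_partial_expectation_le (H : FinHypergraph α) {d k j : ℕ} {a : ℝ}
    (ha : a = 2 ^ (d + 1) ∨ a = 5 * d) (ha0 : 0 < a) (hkd : k ≤ d) (hjk : j < k) (hj : 2 ≤ j)
    {X : Finset α} (hX : X ⊆ H.verts) (hXne : X.Nonempty) (hXj : X.card < j)
    (hpos : 0 < H.maxDeg k) {T : Finset α} (hT : T ⊆ H.verts) (hTq : T.card ≤ k - j) :
    (((H.migrants k j X).filter fun w => T ⊆ w.2).card : ℝ) *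
      (1 / (a * (H.totalMaxDeg : ℝ))) ^ (k - j - T.card) ≤ (H.maxDeg k : ℝ) ^ (j - X.card) := by
  have hD : (0 : ℝ) < H.maxDeg k := by exact_mod_cast hpos
  have hDD : (H.maxDeg k : ℝ) ≤ H.totalMaxDeg := by
    exact_mod_cast H.maxDeg_le_totalMaxDeg (by omega)
  have hDt : (0 : ℝ) < H.totalMaxDeg := hD.trans_le hDD
  by_cases hXT : Disjoint X T
  · have hc := Finset.card_union_of_disjoint hXT
    have hX0 := hXne.card_pos
    set s := k - j - T.card with hs
    have h1 : (((H.migrants k j X).filter fun w => T ⊆ w.2).card : ℝ) ≤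
        (H.maxDeg k : ℝ) ^ (k - (X ∪ T).card) * a ^ s := by
      have h2 : (((H.migrants k j X).filter fun w => T ⊆ w.2).card : ℝ) ≤
          ((H.nbr (k - (X ∪ T).card) (X ∪ T)).card : ℝ) * ((k - (X ∪ T).card).choose s : ℝ) := by
        exact_mod_cast H.card_migrants_superset_le (k := k) (j := j) hXT
      refine h2.trans (mul_le_mul ?_ ?_ (by positivity) (by positivity))
      · exact H.card_nbr_le (Finset.union_subset hX hT) (by omega) (by omega)
      · exact choose_le_pow_of_marking_constant ha (by omega)
    -- The `s` surplus factors `Δ_k` are cancelled by the `s` factors `1 / Δ` in the marking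
    -- probability.
    have he : k - (X ∪ T).card = (j - X.card) + s := by omega
    calc _ ≤ (H.maxDeg k : ℝ) ^ (k - (X ∪ T).card) * a ^ s * (1 / (a * (H.totalMaxDeg : ℝ))) ^ s :=
          mul_le_mul_of_nonneg_right h1 (by positivity)
      _ = (H.maxDeg k : ℝ) ^ (j - X.card) * (H.maxDeg k / H.totalMaxDeg : ℝ) ^ s := by
          rw [he, pow_add, mul_assoc, mul_assoc, ← mul_pow, ← mul_pow]
          congr 2
          field_simp
      _ ≤ _ := mul_le_of_le_one_right (by positivity)
          (pow_le_one₀ (by positivity) ((div_le_one hDt).2 hDD))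
  · have : (H.migrants k j X).filter (fun w => T ⊆ w.2) = ∅ := by
      refine Finset.eq_empty_of_forall_notMem fun w hw => hXT ?_
      obtain ⟨hw, hTw⟩ := Finset.mem_filter.1 hw
      obtain ⟨⟨hW, -⟩, hZW, -⟩ := mem_migrants.1 hw
      exact (mem_nbr.1 hW).2.2.1.mono_right (hTw.trans hZW)
    rw [this, Finset.card_empty, Nat.cast_zero, zero_mul]
    positivity

lemma migrants_eq_empty (H : FinHypergraph α) {k j : ℕ} {X : Finset α} (hX : X ⊆ H.verts)
    (hXne : X.Nonempty) (hXk : X.card < k) (h0 : H.maxDeg k = 0) : H.migrants k j X = ∅ := by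
  have h := H.card_nbr_le hX hXne.card_pos hXk
  rw [h0, NNReal.coe_zero, zero_pow (by omega)] at h
  have hn : H.nbr (k - X.card) X = ∅ := by
    rw [← Finset.card_eq_zero]
    exact_mod_cast le_antisymm h (by positivity)
  rw [migrants, hn, Finset.empty_product, Finset.filter_empty]

/-! ### The increase of a degree in one stage -/

/-- For a surviving edge `X ∪ Y = e \ I'`, the deleted part `Z = e ∩ I'` is marked, and `(Y ∪ Z, Z)`
is a migrant unless `Z` is empty. Discarding non-minimal edges and singletons only lowers degrees.
-/
lemma nbr_stage_subset (H : FinHypergraph α) {d j : ℕ} (hd : H.dim ≤ d) {X : Finset α}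
    (hXj : X.card < j) (S : Finset α) :
    (H.stage S).nbr (j - X.card) X ⊆ H.nbr (j - X.card) X ∪
      (Finset.Ioc j d).biUnion fun k =>
        ((H.migrants k j X).filter fun w => w.2 ⊆ S).image fun w => w.1 \ w.2 := by
  intro Y hY
  obtain ⟨hYV, he, hdisj, hYc⟩ := mem_nbr.1 hY
  have hYV' : Y ⊆ H.verts := fun v hv =>
    (Finset.mem_sdiff.1 (Finset.mem_filter.1 (hYV hv)).1).1
  have htr : X ∪ Y ∈ H.trimmed S := (Finset.mem_filter.1 (Finset.mem_filter.1 he).1).1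
  obtain ⟨e, heE, heq⟩ := Finset.mem_image.1 htr
  set Z := e ∩ H.added S with hZ
  have hun : X ∪ (Y ∪ Z) = e := by
    rw [← Finset.union_assoc, ← heq, hZ, Finset.sdiff_union_inter]
  have hdZ : Disjoint (X ∪ Y) Z := by
    rw [← heq, hZ]
    exact Finset.disjoint_sdiff_inter e _
  obtain ⟨hXZ, hYZ⟩ := Finset.disjoint_union_left.1 hdZ
  have hZS : Z ⊆ S := Finset.inter_subset_right.trans (Finset.filter_subset _ _)
  have hZV : Z ⊆ H.verts := Finset.inter_subset_left.trans (H.edge_subset e heE)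
  have hec : e.card = j + Z.card := by
    rw [← hun, ← Finset.union_assoc, Finset.card_union_of_disjoint hdZ,
      Finset.card_union_of_disjoint hdisj]
    omega
  have hed : e.card ≤ d := (Finset.le_sup (f := Finset.card) heE).trans hd
  rw [Finset.mem_union]
  rcases Z.eq_empty_or_nonempty with h0 | hne
  · left
    rw [h0, Finset.union_empty] at hun
    exact mem_nbr.2 ⟨hYV', hun ▸ heE, hdisj, hYc⟩
  · right
    have hZpos := hne.card_pos
    refine Finset.mem_biUnion.2 ⟨e.card, Finset.mem_Ioc.2 ⟨by omega, hed⟩,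
      Finset.mem_image.2 ⟨(Y ∪ Z, Z), Finset.mem_filter.2 ⟨mem_migrants.2 ⟨⟨mem_nbr.2
        ⟨Finset.union_subset hYV' hZV, hun ▸ heE, Finset.disjoint_union_right.2 ⟨hdisj, hXZ⟩, ?_⟩,
        hZV⟩, Finset.subset_union_right, by simp only; omega⟩, hZS⟩, ?_⟩⟩
    · rw [Finset.card_union_of_disjoint hYZ]
      omega
    · exact Finset.union_sdiff_cancel_right hYZ

lemma rpow_add_sum_le {ι : Type*} (s : Finset ι) (A : ℝ≥0) (B : ι → ℝ≥0) {r : ℝ} (h0 : 0 < r)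
    (h1 : r ≤ 1) : (A + ∑ i ∈ s, B i) ^ r ≤ A ^ r + ∑ i ∈ s, B i ^ r := by
  refine (NNReal.rpow_add_le_add_rpow _ _ h0.le h1).trans (add_le_add le_rfl ?_)
  exact Finset.le_sum_of_subadditive (fun x : ℝ≥0 => x ^ r) (NNReal.zero_rpow h0.ne').le
    (fun x y => NNReal.rpow_add_le_add_rpow x y h0.le h1) s B

lemma increase_le_sum (H : FinHypergraph α) {d j : ℕ} (hd : H.dim ≤ d) {X : Finset α}
    (hXj : X.card < j) (S : Finset α) :
    H.increase S j X ≤ ∑ k ∈ Finset.Ioc j d,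
      (((H.migrants k j X).filter fun w => w.2 ⊆ S).card : ℝ) ^ (1 / ((j - X.card : ℕ) : ℝ)) := by
  have hr : (1 : ℝ) ≤ ((j - X.card : ℕ) : ℝ) := by
    exact_mod_cast (by omega : 1 ≤ j - X.card)
  have hr0 : 0 < 1 / ((j - X.card : ℕ) : ℝ) := by positivity
  have hr1 : 1 / ((j - X.card : ℕ) : ℝ) ≤ 1 := (div_le_one (by linarith)).2 hr
  have hcard : ((H.stage S).nbr (j - X.card) X).card ≤ (H.nbr (j - X.card) X).card +
      ∑ k ∈ Finset.Ioc j d, ((H.migrants k j X).filter fun w => w.2 ⊆ S).card :=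
    (Finset.card_le_card (H.nbr_stage_subset hd hXj S)).trans <|
      (Finset.card_union_le _ _).trans <| Nat.add_le_add_left
        (Finset.card_biUnion_le.trans (Finset.sum_le_sum fun _ _ => Finset.card_image_le)) _
  have hcard' : (((H.stage S).nbr (j - X.card) X).card : ℝ≥0) ≤ (H.nbr (j - X.card) X).card +
      ∑ k ∈ Finset.Ioc j d, (((H.migrants k j X).filter fun w => w.2 ⊆ S).card : ℝ≥0) := by
    exact_mod_cast hcard
  have h := (NNReal.rpow_le_rpow hcard' hr0.le).trans (rpow_add_sum_le _ _ _ hr0 hr1)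
  rw [increase, sub_le_iff_le_add']
  have h' := NNReal.coe_le_coe.2 h
  push_cast at h'
  simpa only [normDeg, NNReal.coe_rpow, NNReal.coe_natCast] using h'

/-- The event that too many edges of size `k` migrate to the neighbourhood of `X` in size `j`. -/
def Overflow (H : FinHypergraph α) (R : ℝ) (k j : ℕ) (X S : Finset α) : Prop :=
  (H.maxDeg k : ℝ) ^ (j - X.card) * R ^ (k - j) ≤
    (((H.migrants k j X).filter fun w => w.2 ⊆ S).card : ℝ)

lemma rpow_card_migrants_lt (H : FinHypergraph α) {L : ℝ} (hL : 1 ≤ L) {k j : ℕ}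
    {X S : Finset α} (hXj : X.card < j) (h : ¬ H.Overflow (L ^ 2) k j X S) :
    (((H.migrants k j X).filter fun w => w.2 ⊆ S).card : ℝ) ^ (1 / ((j - X.card : ℕ) : ℝ)) <
      L ^ (2 * (k - j)) * H.maxDeg k := by
  have hr : j - X.card ≠ 0 := by omega
  have hr' : (0 : ℝ) < ((j - X.card : ℕ) : ℝ) := by exact_mod_cast Nat.pos_of_ne_zero hr
  rw [one_div, Real.rpow_inv_lt_iff_of_pos (by positivity) (by positivity) hr', Real.rpow_natCast]
  refine (not_le.1 h).trans_le ?_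
  rw [mul_pow, mul_comm, pow_mul]
  refine mul_le_mul_of_nonneg_right ?_ (by positivity)
  -- The root would even shrink the power of `L`; as `L ≥ 1`, this gain can be given away.
  exact le_self_pow₀ (one_le_pow₀ (one_le_pow₀ hL)) hr

lemma increase_bound_of_not_overflow (H : FinHypergraph α) {n d j : ℕ} (hd : H.dim ≤ d)
    (hL : 1 ≤ Real.log n) {X S : Finset α} (hX : X ⊆ H.verts) (hXne : X.Nonempty)
    (hXj : X.card < j)
    (h : ∀ k ∈ Finset.Ioc j d, 0 < H.maxDeg k → ¬ H.Overflow (Real.log n ^ 2) k j X S) :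
    H.increase S j X ≤ H.migrationBound n d j ∧
      (0 < H.migrationBound n d j → H.increase S j X < H.migrationBound n d j) := by
  have hr' : (0 : ℝ) < ((j - X.card : ℕ) : ℝ) := by
    exact_mod_cast (by omega : 0 < j - X.card)
  have hle : ∀ k ∈ Finset.Ioc j d,
      (((H.migrants k j X).filter fun w => w.2 ⊆ S).card : ℝ) ^ (1 / ((j - X.card : ℕ) : ℝ)) ≤
        Real.log n ^ (2 * (k - j)) * H.maxDeg k := by
    intro k hk
    -- The tail bound needs `Δ_k > 0`; for `Δ_k = 0` there are no migrants.
    rcases (zero_le (a := H.maxDeg k)).eq_or_lt with h0 | hpos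
    · rw [H.migrants_eq_empty hX hXne (hXj.trans (Finset.mem_Ioc.1 hk).1) h0.symm, ← h0]
      simp [hr'.ne']
    · exact (H.rpow_card_migrants_lt hL hXj (h k hk hpos)).le
  refine ⟨(H.increase_le_sum hd hXj S).trans (Finset.sum_le_sum hle), fun hpos => ?_⟩
  refine (H.increase_le_sum hd hXj S).trans_lt (Finset.sum_lt_sum hle ?_)
  obtain ⟨k, hk, hkpos⟩ := Finset.exists_lt_of_sum_lt
    (s := Finset.Ioc j d) (f := fun _ => (0 : ℝ)) (by simpa [migrationBound] using hpos)
  refine ⟨k, hk, H.rpow_card_migrants_lt hL hXj (h k hk ?_)⟩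
  exact NNReal.coe_pos.1 (pos_of_mul_pos_right hkpos (by positivity))

/-! ### Union bound and numerical estimates -/

/-- The union bound for the complement of a family of events. -/
lemma one_sub_sum_le_markProb {ι : Type*} (H : FinHypergraph α) {p : ℝ} (hp0 : 0 ≤ p)
    (hp1 : p ≤ 1) (P : Finset α → Prop) (B : Finset ι) (Q : ι → Finset α → Prop)
    (hPQ : ∀ S, (∀ b ∈ B, ¬ Q b S) → P S) {ε : ℝ} [∀ b, DecidablePred (Q b)]
    (hε : ∀ b ∈ B, ∑ S ∈ H.verts.powerset.filter (Q b), weight H.verts p S ≤ ε) :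
    1 - B.card * ε ≤ H.markProb p P := by
  classical
  have hw := weight_nonneg H.verts hp0 hp1
  have hm : H.markProb p P = ∑ S ∈ H.verts.powerset.filter P, weight H.verts p S := by
    rw [markProb]
    exact Finset.sum_congr (by congr) fun _ _ => rfl
  have hsplit := Finset.sum_filter_add_sum_filter_not H.verts.powerset P (weight H.verts p)
  rw [sum_weight] at hsplit
  have hbad : ∑ S ∈ H.verts.powerset.filter (fun S => ¬ P S), weight H.verts p S ≤
      B.card * ε :=
    calc _ ≤ ∑ S ∈ H.verts.powerset, ∑ b ∈ B, if Q b S then weight H.verts p S else 0 := by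
          rw [Finset.sum_filter]
          refine Finset.sum_le_sum fun S _ => ?_
          have hnn : ∀ b ∈ B, 0 ≤ if Q b S then weight H.verts p S else 0 := by
            intro b _
            split_ifs
            exacts [hw S, le_rfl]
          by_cases hP : P S
          · simpa [hP] using Finset.sum_nonneg hnn
          · obtain ⟨b, hb, hQ⟩ : ∃ b ∈ B, Q b S := by
              by_contra! hcon
              exact hP (hPQ S hcon)
            simpa [hP, hQ] using Finset.single_le_sum hnn hb
      _ = ∑ b ∈ B, ∑ S ∈ H.verts.powerset.filter (Q b), weight H.verts p S := by
          rw [Finset.sum_comm]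
          exact Finset.sum_congr rfl fun b _ => (Finset.sum_filter _ _).symm
      _ ≤ B.card • ε := Finset.sum_le_card_nsmul _ _ _ hε
      _ = _ := nsmul_eq_mul _ _
  rw [hm]
  linarith

lemma markingProbability_mem (H : FinHypergraph α) {d : ℕ} {a : ℝ}
    (ha : a = 2 ^ (d + 1) ∨ a = 5 * d) :
    0 ≤ 1 / (a * (H.totalMaxDeg : ℝ)) ∧ 1 / (a * (H.totalMaxDeg : ℝ)) ≤ 1 := by
  have ha' : a = 0 ∨ 1 ≤ a := by
    rcases ha with rfl | rfl
    · exact Or.inr (one_le_pow₀ (by norm_num))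
    · rcases Nat.eq_zero_or_pos d with rfl | hd
      · simp
      · right
        have : (1 : ℝ) ≤ d := by exact_mod_cast hd
        linarith
  rcases ha' with rfl | ha1
  · simp
  rcases (zero_le (a := H.totalMaxDeg)).eq_or_lt with h0 | hpos
  · simp [← h0]
  have h1 : (1 : ℝ) ≤ H.totalMaxDeg := by exact_mod_cast H.one_le_totalMaxDeg hpos
  have h2 : 1 ≤ a * (H.totalMaxDeg : ℝ) := one_le_mul_of_one_le_of_one_le ha1 h1
  exact ⟨by positivity, (div_le_one (by linarith)).2 h2⟩

open Classical in
lemma overflow_prob_le (H : FinHypergraph α) {d k j : ℕ} {a R : ℝ}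
    (ha : a = 2 ^ (d + 1) ∨ a = 5 * d) (hkd : k ≤ d) (hjk : j < k) (hj : 2 ≤ j)
    {X : Finset α} (hX : X ⊆ H.verts) (hXne : X.Nonempty) (hXj : X.card < j)
    (hpos : 0 < H.maxDeg k) (hR : 0 < R) :
    ∑ S ∈ H.verts.powerset.filter (H.Overflow R k j X),
      weight H.verts (1 / (a * (H.totalMaxDeg : ℝ))) S ≤ Real.exp (d - R / Real.exp 1) := by
  have ha0 : 0 < a := by
    rcases ha with rfl | rfl
    · positivity
    · have : (0 : ℝ) < d := by exact_mod_cast (by omega : 0 < d)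
      positivity
  obtain ⟨hp0, hp1⟩ := H.markingProbability_mem ha
  have hM0 : (0 : ℝ) < (H.maxDeg k : ℝ) ^ (j - X.card) := pow_pos (by exact_mod_cast hpos) _
  have h := tail_le H.verts hp0 hp1 (q := k - j) (by omega) (H.migrants k j X) Prod.snd
    (fun w hw => (mem_migrants.1 hw).1.2) (fun w hw => (mem_migrants.1 hw).2.2)
    (fun T hT hTq => H.migrants_partial_expectation_le ha ha0 hkd hjk hj hX hXne hXj hpos hT hTq)
    hM0 hR
  have hqd : ((k - j : ℕ) : ℝ) ≤ d := by exact_mod_cast (by omega : k - j ≤ d)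
  refine le_trans ?_ (h.trans (Real.exp_le_exp.2 (by linarith)))
  exact le_of_eq (Finset.sum_congr (by ext S; simp [Overflow]) fun _ _ => rfl)

lemma union_bound_le {n d N : ℕ} {L : ℝ} (hn : (n : ℝ) = Real.exp L) (hL : 3 ≤ L)
    (hd : (d : ℝ) ≤ L / 18) (hN : N ≤ (d + 1) * ((d + 1) * (n + 1) ^ d)) :
    (N : ℝ) * Real.exp (d - L ^ 2 / Real.exp 1) ≤ Real.exp (-(1 / 6 * L) * L) := by
  have hd0 : (0 : ℝ) ≤ d := Nat.cast_nonneg d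
  have h1 : ((d : ℝ) + 1) ≤ Real.exp d := Real.add_one_le_exp _
  have h2 : ((n : ℝ) + 1) ^ d ≤ Real.exp (d * (2 * L)) := by
    rw [Real.exp_nat_mul]
    refine pow_le_pow_left₀ (by positivity) ?_ _
    have : L + 1 ≤ Real.exp L := Real.add_one_le_exp L
    rw [hn, two_mul, Real.exp_add]
    nlinarith
  have h3 : (N : ℝ) ≤ Real.exp d * (Real.exp d * Real.exp (d * (2 * L))) :=
    calc (N : ℝ) ≤ ((d : ℝ) + 1) * (((d : ℝ) + 1) * ((n : ℝ) + 1) ^ d) := by exact_mod_cast hN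
      _ ≤ _ := by gcongr
  have h4 : L ^ 2 / 3 ≤ L ^ 2 / Real.exp 1 :=
    div_le_div_of_nonneg_left (by positivity) (Real.exp_pos 1)
      (Real.exp_one_lt_d9.le.trans (by norm_num))
  refine (mul_le_mul_of_nonneg_right h3 (Real.exp_pos _).le).trans ?_
  rw [← Real.exp_add, ← Real.exp_add, ← Real.exp_add]
  refine Real.exp_le_exp.2 ?_
  -- The exponent is at most `3 * d + 2 * d * L - L ^ 2 / 3 ≤ 3 * d * L - L ^ 2 / 3`; `d ≤ L / 18`
  -- makes this at most `-L ^ 2 / 6`, whence `c = 1 / 6`.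
  have h5 : (d : ℝ) * 3 ≤ d * L := mul_le_mul_of_nonneg_left hL hd0
  have h6 : (d : ℝ) * L ≤ L / 18 * L := mul_le_mul_of_nonneg_right hd (by linarith)
  nlinarith

lemma one_sub_exp_le_markProb (H : FinHypergraph α) {n d : ℕ} {a : ℝ} (hL : 3 ≤ Real.log n)
    (hd : (d : ℝ) ≤ Real.log n / 18) (ha : a = 2 ^ (d + 1) ∨ a = 5 * d)
    (hn : H.verts.card ≤ n) (hdim : H.dim ≤ d) :
    1 - Real.exp (-(1 / 6 * Real.log n) * Real.log n) ≤
      H.markProb (1 / (a * (H.totalMaxDeg : ℝ))) fun S =>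
        ∀ j : ℕ, 2 ≤ j → j ≤ d →
        ∀ X : Finset α, X ⊆ H.verts → X.Nonempty → X.card < j →
          H.increase S j X ≤ H.migrationBound n d j ∧
          (0 < H.migrationBound n d j → H.increase S j X < H.migrationBound n d j) := by
  classical
  obtain ⟨hp0, hp1⟩ := H.markingProbability_mem ha
  have hn0 : (n : ℝ) ≠ 0 := by
    rintro h
    rw [h, Real.log_zero] at hL
    norm_num at hL
  set D := Finset.range (d + 1) ×ˢ Finset.range (d + 1) ×ˢ
    H.verts.powerset.filter fun X => X.card ≤ d with hD
  set B := D.filter fun b =>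
    2 ≤ b.1 ∧ b.1 < b.2.1 ∧ b.2.2.Nonempty ∧ b.2.2.card < b.1 ∧ 0 < H.maxDeg b.2.1 with hB
  have hcard : B.card ≤ (d + 1) * ((d + 1) * (n + 1) ^ d) := by
    refine (Finset.card_filter_le _ _).trans ?_
    rw [hD, Finset.card_product, Finset.card_product, Finset.card_range]
    gcongr
    exact (card_subsets_card_le _ _).trans (Nat.pow_le_pow_left (by omega) _)
  refine le_trans (sub_le_sub_left (union_bound_le (Real.exp_log (by positivity)).symm hL hd hcard)
    1) ?_
  refine H.one_sub_sum_le_markProb hp0 hp1 _ B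
    (fun b => H.Overflow (Real.log n ^ 2) b.2.1 b.1 b.2.2) ?_ ?_
  · intro S hS j hj hjd X hX hXne hXj
    refine H.increase_bound_of_not_overflow hdim (by linarith) hX hXne hXj fun k hk hpos => ?_
    obtain ⟨hjk, hkd⟩ := Finset.mem_Ioc.1 hk
    refine hS (j, k, X) (Finset.mem_filter.2 ⟨?_, hj, hjk, hXne, hXj, hpos⟩)
    simp only [hD, Finset.mem_product, Finset.mem_range, Finset.mem_filter, Finset.mem_powerset]
    exact ⟨by omega, by omega, hX, by omega⟩
  · rintro ⟨j, k, X⟩ hb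
    obtain ⟨hbD, hj, hjk, hXne, hXj, hpos⟩ := Finset.mem_filter.1 hb
    simp only [hD, Finset.mem_product, Finset.mem_range, Finset.mem_filter,
      Finset.mem_powerset] at hbD
    exact H.overflow_prob_le ha (Nat.lt_succ_iff.1 hbD.2.1) hjk hj hbD.2.2.1 hXne hXj hpos
      (by positivity)

open Filter in
-- The dimension hypothesis enters only through `d ≤ log n / 18`, for which `log log n = o(log n)`
-- suffices once the denominator is at least `1`.
lemma eventually_dimension_bound : ∀ᶠ n : ℕ in atTop, 3 ≤ Real.log n ∧
    Real.log (Real.log n) / (4 * Real.log (Real.log (Real.log n))) ≤ Real.log n / 18 := by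
  have hlog : Tendsto (fun n : ℕ => Real.log n) atTop atTop :=
    Real.tendsto_log_atTop.comp tendsto_natCast_atTop_atTop
  have hloglog := Real.tendsto_log_atTop.comp hlog
  have hlogloglog := Real.tendsto_log_atTop.comp hloglog
  have hsmall := hlog.eventually
    (Real.isLittleO_log_id_atTop.bound (by norm_num : (0 : ℝ) < 1 / 18))
  filter_upwards [hlog.eventually_ge_atTop 3, hloglog.eventually_ge_atTop 0,
    hlogloglog.eventually_ge_atTop 1, hsmall] with n h1 h2 h3 h4
  simp only [Function.comp_apply, id_eq, Real.norm_eq_abs] at h2 h3 h4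
  rw [abs_of_nonneg h2, abs_of_nonneg (by linarith)] at h4
  exact ⟨h1, (div_le_self h2 (by linarith)).trans (by linarith)⟩

end FinHypergraph

theorem mainTheorem4 :
    ∃ c : ℝ, 0 < c ∧ ∃ n₀ : ℕ, ∀ n : ℕ, n₀ ≤ n →
      ∀ d : ℕ, (d : ℝ) ≤ Real.log (Real.log n) / (4 * Real.log (Real.log (Real.log n))) →
      ∀ a : ℝ, a = 2 ^ (d + 1) ∨ a = 5 * d →
      ∀ (α : Type*) [DecidableEq α] (H : FinHypergraph α),
        H.verts.card ≤ n → H.dim ≤ d →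
        1 - (n : ℝ) ^ (-(c * Real.log n)) ≤
          H.markProb (1 / (a * (H.totalMaxDeg : ℝ))) fun S =>
            ∀ j : ℕ, 2 ≤ j → j ≤ d →
            ∀ X : Finset α, X ⊆ H.verts → X.Nonempty → X.card < j →
              H.increase S j X ≤ H.migrationBound n d j ∧
              (0 < H.migrationBound n d j → H.increase S j X < H.migrationBound n d j) := by
  obtain ⟨n₀, hn₀⟩ := Filter.eventually_atTop.1 FinHypergraph.eventually_dimension_bound
  refine ⟨1 / 6, by norm_num, n₀, fun n hn d hd a ha α _ H hV hdim => ?_⟩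
  obtain ⟨hL, hdL⟩ := hn₀ n hn
  have hpos : (0 : ℝ) < n := by
    refine (Nat.cast_nonneg n).lt_of_ne fun h => ?_
    rw [← h, Real.log_zero] at hL
    norm_num at hL
  rw [Real.rpow_def_of_pos hpos, mul_comm]
  exact H.one_sub_exp_le_markProb hL (hd.trans hdL) ha hV hdim
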